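/- Let $n\ge 1$, $X\subseteq\{0,1\}^n$ and $f:X\to\{0,1\}$. A family of vectors $v=(v_{x,j})_{x\in X,\,j\in[n]}$ in $\mathbb C^m$ is an $f$-deciding vector set of dimension $m$ if $\sum_{j:\,x_j\neq y_j}\langle v_{x,j},v_{y,j}\rangle=1$ for all $x,y\in X$ with $f(x)\neq f(y)$. Its size is $A=\max_{x\in X}\sum_{j}\|v_{x,j}\|^2$ (with $A=0$ if $X=\emptyset$). Put $W_j=\operatorname{span}\{v_{x,j}:f(x)=1\}$ and $\kappa'_j=\dim W_j$; the maximum rank is $\kappa'=\max_{j\in[n]}\kappa'_j$. A quantum query algorithm with $T$ queries acts on $\mathbb C^n\otimes\mathbb C^2\otimes\mathbb C^w$ for some $w\ge 1$. On input $x$ it prepares $U_T O_x U_{T-1}O_x\cdots U_1 O_x U_0|\hat 0\rangle$, where $|\hat 0\rangle$ is a fixed standard basis state, $O_x|i\rangle|b\rangle|a\rangle=|i\rangle|b\oplus x_i\rangle|a\rangle$, and the unitaries $U_t$ do not depend on $x$; it then makes a two-outcome projective measurement that does not depend on $x$. It decides $f$ if for every $x\in X$ the outcome is $f(x)$ with probability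 at least $2/3$. It uses $\lceil\log_2(2nw)\rceil$ qubits. Theorem (exact compression). There is an absolute constant $C>0$ such that for all $n\ge1$, $X\subseteq\{0,1\}^n$, $f:X\to\{0,1\}$, $m\in\mathbb N$ and every $f$-deciding vector set $(v_{x,j})$ in $\mathbb C^m$ of size $A$ and maximum rank $\kappa'$ the following hold. (1) For each $j\in[n]$ there is a linear map $S_j:\mathbb C^m\to\mathbb C^{\kappa'}$ that is a partial isometry with initial space $W_j$ (isometric on $W_j$ and zero on $W_j^\perp$) and with range the span of the first $\kappa'_j$ standard basis vectors, such that $(S_jv_{x,j})_{x\in X,\,j\in[n]}$ is an $f$-deciding vector set, of dimension $\kappa'$ and size at most $A$. (2) There is a quantum query algorithm that decides $f$ with at most $C\,A$ queries and at most $C\,(1+\log_2(n\max\{1,\kappa'\}))$ qubits, that is, with $O(A)$ queries and $O(\log(n\kappa'))$ qubits. -/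

import Mathlib

open scoped Matrix

noncomputable section

/-! ### Deciding vector sets -/

/-- `v` is an `f`-deciding vector set (of dimension `m`) for `f : X → {0,1}`, `X ⊆ {0,1}ⁿ`:
`∑_{j : x_j ≠ y_j} ⟨v_{x,j}, v_{y,j}⟩ = 1` whenever `f x ≠ f y`. -/
def IsDeciding {n m : ℕ} {X : Set (Fin n → Bool)} (f : X → Bool)
    (v : X → Fin n → EuclideanSpace ℂ (Fin m)) : Prop :=
  ∀ x y : X, f x ≠ f y →
    ∑ j : Fin n with x.1 j ≠ y.1 j, inner ℂ (v x j) (v y j) = 1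

/-- The size `max_{x ∈ X} ∑_j ‖v_{x,j}‖²` (equal to `0` if `X` is empty). -/
def vecSize {n m : ℕ} {X : Set (Fin n → Bool)}
    (v : X → Fin n → EuclideanSpace ℂ (Fin m)) : ℝ :=
  ⨆ x : X, ∑ j : Fin n, ‖v x j‖ ^ 2

/-- The span of the `1`-input vectors at coordinate `j`. -/
def oneSpan {n m : ℕ} {X : Set (Fin n → Bool)} (f : X → Bool)
    (v : X → Fin n → EuclideanSpace ℂ (Fin m)) (j : Fin n) :
    Submodule ℂ (EuclideanSpace ℂ (Fin m)) :=
  Submodule.span ℂ {u | ∃ x : X, f x = true ∧ v x j = u}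

/-- The rank of the set of `1`-input vectors at coordinate `j`. -/
def rankAt {n m : ℕ} {X : Set (Fin n → Bool)} (f : X → Bool)
    (v : X → Fin n → EuclideanSpace ℂ (Fin m)) (j : Fin n) : ℕ :=
  Module.finrank ℂ (oneSpan f v j)

/-- The maximum rank `max_j rank {v_{x,j} : f x = 1}`. -/
def maxRank {n m : ℕ} {X : Set (Fin n → Bool)} (f : X → Bool)
    (v : X → Fin n → EuclideanSpace ℂ (Fin m)) : ℕ :=
  Finset.univ.sup (rankAt f v)

/-- `S` is a partial isometry with initial space `W` and final space `W'`. -/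
def IsPartialIsometryBetween {m k : ℕ}
    (S : EuclideanSpace ℂ (Fin m) →ₗ[ℂ] EuclideanSpace ℂ (Fin k))
    (W : Submodule ℂ (EuclideanSpace ℂ (Fin m)))
    (W' : Submodule ℂ (EuclideanSpace ℂ (Fin k))) : Prop :=
  (∀ u ∈ W, ‖S u‖ = ‖u‖) ∧ (∀ u ∈ Wᗮ, S u = 0) ∧ LinearMap.range S = W'

/-- The span of the first `r` standard basis vectors of `ℂᵏ`. -/
def firstBasisSpan (k r : ℕ) : Submodule ℂ (EuclideanSpace ℂ (Fin k)) :=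
  Submodule.span ℂ {u | ∃ i : Fin k, (i : ℕ) < r ∧ EuclideanSpace.single i (1 : ℂ) = u}

/-! ### Quantum query algorithms -/

/-- Labels `(i, b, a)` of the standard basis states `|i⟩|b⟩|a⟩` of `ℂⁿ ⊗ ℂ² ⊗ ℂʷ`:
query index, answer bit, workspace. -/
abbrev BasisState (n w : ℕ) : Type := Fin n × Bool × Fin w

/-- The oracle `O_x ⊗ I`, acting by `|i⟩|b⟩|a⟩ ↦ |i⟩|b ⊕ x_i⟩|a⟩`. -/
def oracle {n : ℕ} (w : ℕ) (x : Fin n → Bool) :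
    Matrix (BasisState n w) (BasisState n w) ℂ :=
  Matrix.of fun p q => if p = (q.1, Bool.xor q.2.1 (x q.1), q.2.2) then 1 else 0

/-- A quantum query algorithm on `n`-bit inputs: it runs
`U_T O_x U_{T-1} O_x ⋯ U_1 O_x U_0` on a fixed basis state and ends with a two-outcome projective
measurement. Nothing here depends on the input. -/
structure QueryAlgorithm (n : ℕ) where
  /-- dimension of the workspace, besides the query registers -/
  work : ℕ
  /-- the number `T` of oracle calls -/
  queries : ℕ
  /-- the unitaries; only `U 0, …, U queries` are used -/
  U : ℕ → Matrix.unitaryGroup (BasisState n work) ℂ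
  /-- label of the initial state -/
  start : BasisState n work
  /-- the projector onto outcome `1` -/
  accept : Matrix (BasisState n work) (BasisState n work) ℂ
  accept_proj : IsStarProjection accept

namespace QueryAlgorithm

/-- The state after `t` oracle calls on input `x` (and the unitary following them). -/
def state {n : ℕ} (Q : QueryAlgorithm n) (x : Fin n → Bool) : ℕ → (BasisState n Q.work → ℂ)
  | 0 => (Q.U 0).1 *ᵥ Pi.single Q.start 1
  | t + 1 => (Q.U (t + 1)).1 *ᵥ (oracle Q.work x *ᵥ state Q x t)

/-- The projector belonging to an outcome. -/
def outcomeProj {n : ℕ} (Q : QueryAlgorithm n) (b : Bool) :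
    Matrix (BasisState n Q.work) (BasisState n Q.work) ℂ :=
  if b then Q.accept else 1 - Q.accept

/-- The probability that the algorithm outputs `b` on input `x`. -/
def prob {n : ℕ} (Q : QueryAlgorithm n) (x : Fin n → Bool) (b : Bool) : ℝ :=
  ∑ p, ‖(Q.outcomeProj b *ᵥ Q.state x Q.queries) p‖ ^ 2

/-- The algorithm decides `f` with bounded error. -/
def Decides {n : ℕ} (Q : QueryAlgorithm n) {X : Set (Fin n → Bool)} (f : X → Bool) : Prop :=
  ∀ x : X, 2 / 3 ≤ Q.prob x.1 (f x)

/-- The number of qubits that hold the whole Hilbert space `ℂⁿ ⊗ ℂ² ⊗ ℂʷ`. -/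
def qubits {n : ℕ} (Q : QueryAlgorithm n) : ℕ := Nat.clog 2 (Fintype.card (BasisState n Q.work))

end QueryAlgorithm

end

/-! Compression (`exists_compression`): project onto `W_j`, then embed isometrically. Every
constraint pairs a `1`-input with a `0`-input. The `1`-input's vectors already lie in the `W_j`, so
projecting the other side changes no inner product, and a contraction cannot increase the size.

Algorithm: take orthonormal states `e`, `o` and compressed vectors `u`, and let `K` be spanned by
`e` and the vectors `o + α ∑_j |j⟩|-⟩|x_j, u_{x,j}⟩` over `1`-inputs `x`. The deciding identity says
exactly that `o - α⁻¹ ∑_j |j⟩|-⟩|¬y_j, u_{y,j}⟩` is orthogonal to `K` for each `0`-input `y`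
(`add_phaseVec_mem_orthogonal_walkSpace`). One query with label signs fixes the first kind of phase
vector on its own input and negates the second. A step is this query, a small rotation from `e`
towards `o`, and the reflection through `K`. On `1`-inputs the rotation accumulates and reaches `o`
up to `O(α√A)` (`norm_iterate_walkStep_sub_le_of_mem`). On `0`-inputs the step has an exact fixed
vector close to `e`, so the state stays within `O(A/T)` of `e`
(`norm_iterate_walkStep_sub_le_of_mem_orthogonal`). A suitable `α` of order `1/√A` and `T = O(A)`
make both errors at most `1/6`. The workspace has only `2 + 2κ'` labels. -/

noncomputable section

/-! ### Compression of a deciding vector set -/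

section Compression

variable {n m : ℕ} {X : Set (Fin n → Bool)}

/-- The standard basis vectors `e₀, …, e_{r-1}` of `ℂᵏ`, for `r ≤ k`. -/
def firstBasisVectors {k r : ℕ} (h : r ≤ k) (i : Fin r) : EuclideanSpace ℂ (Fin k) :=
  EuclideanSpace.single (Fin.castLE h i) 1

theorem orthonormal_firstBasisVectors {k r : ℕ} (h : r ≤ k) :
    Orthonormal ℂ (firstBasisVectors h) :=
  (EuclideanSpace.orthonormal_single (𝕜 := ℂ)).comp _ (Fin.castLE_injective h)

theorem span_range_firstBasisVectors {k r : ℕ} (h : r ≤ k) :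
    Submodule.span ℂ (Set.range (firstBasisVectors h)) = firstBasisSpan k r := by
  unfold firstBasisSpan
  congr 1
  ext u
  constructor
  · rintro ⟨i, rfl⟩
    exact ⟨Fin.castLE h i, i.2, rfl⟩
  · rintro ⟨i, hi, rfl⟩
    exact ⟨⟨i, hi⟩, rfl⟩

/-- A subspace of dimension at most `k` embeds isometrically onto a coordinate subspace of `ℂᵏ`. -/
theorem exists_linearIsometry_range_eq_firstBasisSpan {k : ℕ}
    (W : Submodule ℂ (EuclideanSpace ℂ (Fin m))) (h : Module.finrank ℂ W ≤ k) :
    ∃ J : W →ₗᵢ[ℂ] EuclideanSpace ℂ (Fin k),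
      LinearMap.range J.toLinearMap = firstBasisSpan k (Module.finrank ℂ W) := by
  let b := stdOrthonormalBasis ℂ W
  let g := b.toBasis.constr ℂ (firstBasisVectors h)
  have hb : Orthonormal ℂ b.toBasis := by simp
  have hg : Orthonormal ℂ (g ∘ b.toBasis) := by
    have : g ∘ b.toBasis = firstBasisVectors h := by
      funext i
      exact b.toBasis.constr_basis ℂ _ i
    rw [this]
    exact orthonormal_firstBasisVectors h
  refine ⟨g.isometryOfOrthonormal hb hg, ?_⟩
  rw [LinearMap.isometryOfOrthonormal_toLinearMap, ← span_range_firstBasisVectors h]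
  exact b.toBasis.constr_range ℂ

theorem inner_map_orthogonalProjectionOnto {E F : Type*} [NormedAddCommGroup E]
    [InnerProductSpace ℂ E] [NormedAddCommGroup F] [InnerProductSpace ℂ F] {W : Submodule ℂ E}
    [W.HasOrthogonalProjection] (J : W →ₗᵢ[ℂ] F) {u : E} (hu : u ∈ W) (z : E) :
    inner ℂ (J (W.orthogonalProjectionOnto u)) (J (W.orthogonalProjectionOnto z))
      = inner ℂ u z := by
  rw [J.inner_map_map, Submodule.orthogonalProjectionOnto_mem_subspace_eq_self (K := W) ⟨u, hu⟩]
  exact Submodule.inner_orthogonalProjectionOnto_eq_of_mem_left ⟨u, hu⟩ z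

/-- The map is `J ∘ P`, with `P` the orthogonal projection onto `W`. Since `P` is self-adjoint, one
argument in `W` suffices to preserve an inner product. -/
theorem exists_partialIsometry {k : ℕ} (W : Submodule ℂ (EuclideanSpace ℂ (Fin m)))
    (h : Module.finrank ℂ W ≤ k) :
    ∃ S : EuclideanSpace ℂ (Fin m) →ₗ[ℂ] EuclideanSpace ℂ (Fin k),
      IsPartialIsometryBetween S W (firstBasisSpan k (Module.finrank ℂ W)) ∧
      (∀ z, ‖S z‖ ≤ ‖z‖) ∧ ∀ u ∈ W, ∀ z, inner ℂ (S u) (S z) = inner ℂ u z := by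
  obtain ⟨J, hJ⟩ := exists_linearIsometry_range_eq_firstBasisSpan W h
  let P : EuclideanSpace ℂ (Fin m) →ₗ[ℂ] W := W.orthogonalProjectionOnto.toLinearMap
  have hP : ∀ u (hu : u ∈ W), P u = ⟨u, hu⟩ := fun u hu =>
    Submodule.orthogonalProjectionOnto_mem_subspace_eq_self (K := W) ⟨u, hu⟩
  refine ⟨J.toLinearMap ∘ₗ P, ⟨fun u hu => ?_, fun u hu => ?_, ?_⟩, fun z => ?_, fun u hu z => ?_⟩
  · simp [hP u hu]
  · have : P u = 0 := Submodule.orthogonalProjectionOnto_apply_of_mem_orthogonal hu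
    simp [this]
  · have hsurj : LinearMap.range P = ⊤ := LinearMap.range_eq_top.2 fun w => ⟨w.1, hP w.1 w.2⟩
    exact (LinearMap.range_comp_of_range_eq_top J.toLinearMap hsurj).trans hJ
  · have : ‖P z‖ ≤ ‖z‖ := Submodule.norm_orthogonalProjectionOnto_apply_le W z
    simpa using this
  · exact inner_map_orthogonalProjectionOnto J hu z

theorem sum_norm_sq_le_vecSize (v : X → Fin n → EuclideanSpace ℂ (Fin m)) (x : X) :
    ∑ j, ‖v x j‖ ^ 2 ≤ vecSize v :=
  le_ciSup (f := fun x => ∑ j, ‖v x j‖ ^ 2) (Set.finite_range _).bddAbove x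

theorem vecSize_mono {k : ℕ} {v : X → Fin n → EuclideanSpace ℂ (Fin m)}
    {u : X → Fin n → EuclideanSpace ℂ (Fin k)} (h : ∀ x j, ‖u x j‖ ≤ ‖v x j‖) :
    vecSize u ≤ vecSize v :=
  ciSup_mono (Set.finite_range _).bddAbove fun x =>
    Finset.sum_le_sum fun j _ => pow_le_pow_left₀ (norm_nonneg _) (h x j) 2

theorem vecSize_nonneg (v : X → Fin n → EuclideanSpace ℂ (Fin m)) : 0 ≤ vecSize v :=
  Real.iSup_nonneg fun _ => Finset.sum_nonneg fun _ _ => by positivity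

theorem exists_compression {f : X → Bool} {v : X → Fin n → EuclideanSpace ℂ (Fin m)}
    (hv : IsDeciding f v) :
    ∃ S : Fin n → (EuclideanSpace ℂ (Fin m) →ₗ[ℂ] EuclideanSpace ℂ (Fin (maxRank f v))),
      (∀ j, IsPartialIsometryBetween (S j) (oneSpan f v j)
        (firstBasisSpan (maxRank f v) (rankAt f v j))) ∧
      IsDeciding f (fun x j => S j (v x j)) ∧
      vecSize (fun x j => S j (v x j)) ≤ vecSize v := by
  have hrank : ∀ j, Module.finrank ℂ (oneSpan f v j) ≤ maxRank f v := fun j =>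
    Finset.le_sup (f := rankAt f v) (Finset.mem_univ j)
  choose S hS hle hin using fun j => exists_partialIsometry (oneSpan f v j) (hrank j)
  have hmem : ∀ x, f x = true → ∀ j, v x j ∈ oneSpan f v j := fun x hx j =>
    Submodule.subset_span ⟨x, hx, rfl⟩
  refine ⟨S, hS, fun x y hxy => ?_, vecSize_mono fun x j => hle j _⟩
  rw [← hv x y hxy]
  refine Finset.sum_congr rfl fun j _ => ?_
  cases hx : f x
  · have hy : f y = true := by
      cases hy : f y
      · exact absurd (hx.trans hy.symm) hxy
      · rfl
    -- Here `y` is the `1`-input, so conjugation moves its vector to the left slot.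
    rw [← inner_conj_symm]
    exact (congrArg _ (hin j _ (hmem y hy j) _)).trans (inner_conj_symm _ _)
  · exact hin j _ (hmem x hx j) _

/-- Cauchy–Schwarz and AM–GM bound the constraint's value `1` by the mean of the two inputs' sizes.
This later pays for rounding the number of queries up. -/
theorem one_le_vecSize {f : X → Bool} {v : X → Fin n → EuclideanSpace ℂ (Fin m)}
    (hv : IsDeciding f v) {x y : X} (hxy : f x ≠ f y) : 1 ≤ vecSize v := by
  have key : (1 : ℝ) ≤ ∑ j, (‖v x j‖ ^ 2 + ‖v y j‖ ^ 2) / 2 := by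
    calc (1 : ℝ) = ‖∑ j : Fin n with x.1 j ≠ y.1 j, inner ℂ (v x j) (v y j)‖ := by
          rw [hv x y hxy, norm_one]
      _ ≤ ∑ j : Fin n with x.1 j ≠ y.1 j, ‖inner ℂ (v x j) (v y j)‖ := norm_sum_le _ _
      _ ≤ ∑ j, ‖inner ℂ (v x j) (v y j)‖ :=
          Finset.sum_le_sum_of_subset_of_nonneg (Finset.subset_univ _) fun _ _ _ => norm_nonneg _
      _ ≤ ∑ j, (‖v x j‖ ^ 2 + ‖v y j‖ ^ 2) / 2 := Finset.sum_le_sum fun j _ => by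
          have := norm_inner_le_norm (𝕜 := ℂ) (v x j) (v y j)
          nlinarith [sq_nonneg (‖v x j‖ - ‖v y j‖)]
  rw [← Finset.sum_div, Finset.sum_add_distrib] at key
  linarith [sum_norm_sq_le_vecSize v x, sum_norm_sq_le_vecSize v y]

end Compression

/-! ### Slow rotation against a product of reflections -/

section SlowRotation

variable {E : Type*} [NormedAddCommGroup E] [InnerProductSpace ℂ E]

theorem reflection_orthogonal_singleton_apply {q : E} (hq : ‖q‖ = 1) (x : E) :
    (ℂ ∙ q)ᗮ.reflection x = x - (2 * inner ℂ q x) • q := by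
  rw [Submodule.reflection_orthogonal_apply, Submodule.reflection_singleton_apply, hq]
  simp [two_smul, two_mul, add_smul]

/-- The point at angle `θ` on the circle through `e` and `o`. -/
def circlePoint (e o : E) (θ : ℝ) : E := (Real.cos θ : ℂ) • e + (Real.sin θ : ℂ) • o

/-- The rotation by `2 * φ` in the plane of the orthonormal pair `e`, `o`. -/
def planeRotation (e o : E) (φ : ℝ) : E ≃ₗᵢ[ℂ] E :=
  (ℂ ∙ e)ᗮ.reflection.trans (ℂ ∙ circlePoint e o φ)ᗮ.reflection

variable {e o : E}

theorem norm_circlePoint (he : ‖e‖ = 1) (ho : ‖o‖ = 1) (heo : inner ℂ e o = 0) (θ : ℝ) :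
    ‖circlePoint e o θ‖ = 1 := by
  have h : ‖circlePoint e o θ‖ ^ 2 = 1 := by
    have h0 : inner ℂ ((Real.cos θ : ℂ) • e) ((Real.sin θ : ℂ) • o) = 0 := by
      rw [inner_smul_left, inner_smul_right, heo]; simp
    rw [circlePoint, sq, norm_add_sq_eq_norm_sq_add_norm_sq_of_inner_eq_zero _ _ h0, norm_smul,
      norm_smul, he, ho, Complex.norm_real, Complex.norm_real, mul_one, mul_one,
      Real.norm_eq_abs, Real.norm_eq_abs, abs_mul_abs_self, abs_mul_abs_self]
    linarith [Real.sin_sq_add_cos_sq θ]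
  exact (sq_eq_sq₀ (norm_nonneg _) zero_le_one).1 (by rw [h, one_pow])

theorem planeRotation_apply_of_orthogonal (he : ‖e‖ = 1) (ho : ‖o‖ = 1) (heo : inner ℂ e o = 0)
    (φ : ℝ) {x : E} (hex : inner ℂ e x = 0) (hox : inner ℂ o x = 0) :
    planeRotation e o φ x = x := by
  have hq : inner ℂ (circlePoint e o φ) x = 0 := by
    rw [circlePoint, inner_add_left, inner_smul_left, inner_smul_left, hex, hox]; simp
  rw [planeRotation, LinearIsometryEquiv.trans_apply,
    reflection_orthogonal_singleton_apply he, hex, mul_zero, zero_smul, sub_zero,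
    reflection_orthogonal_singleton_apply (norm_circlePoint he ho heo φ), hq, mul_zero, zero_smul,
    sub_zero]

/-- The first reflection sends angle `θ` to `π - θ`, the second sends `t` to `π + 2φ - t`. -/
theorem planeRotation_circlePoint (he : ‖e‖ = 1) (ho : ‖o‖ = 1) (heo : inner ℂ e o = 0)
    (φ θ : ℝ) :
    planeRotation e o φ (circlePoint e o θ) = circlePoint e o (θ + 2 * φ) := by
  have hee : inner ℂ e e = 1 := by rw [inner_self_eq_norm_sq_to_K, he]; simp
  have hoo : inner ℂ o o = 1 := by rw [inner_self_eq_norm_sq_to_K, ho]; simp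
  have hoe : inner ℂ o e = 0 := by rw [← inner_conj_symm, heo, map_zero]
  have h1 : inner ℂ e (circlePoint e o θ) = Real.cos θ := by
    rw [circlePoint, inner_add_right, inner_smul_right, inner_smul_right, hee, heo, mul_one,
      mul_zero, add_zero]
  have h2 : (ℂ ∙ e)ᗮ.reflection (circlePoint e o θ)
      = (-Real.cos θ : ℂ) • e + (Real.sin θ : ℂ) • o := by
    rw [reflection_orthogonal_singleton_apply he, h1, circlePoint]
    module
  have h3 : inner ℂ (circlePoint e o φ) ((-Real.cos θ : ℂ) • e + (Real.sin θ : ℂ) • o)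
      = -(Real.cos (θ + φ) : ℂ) := by
    rw [circlePoint]
    simp only [inner_add_left, inner_add_right, inner_smul_left, inner_smul_right, hee, hoo, hoe,
      heo, Complex.conj_ofReal, Real.cos_add]
    push_cast
    ring
  rw [planeRotation, LinearIsometryEquiv.trans_apply, h2,
    reflection_orthogonal_singleton_apply (norm_circlePoint he ho heo φ), h3]
  have hc : Real.cos (θ + 2 * φ) = -Real.cos θ + 2 * Real.cos (θ + φ) * Real.cos φ := by
    rw [two_mul φ, ← add_assoc, Real.cos_add (θ + φ) φ, Real.sin_add, Real.cos_add]
    linear_combination (-Real.cos θ) * Real.sin_sq_add_cos_sq φ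
  have hs : Real.sin (θ + 2 * φ) = Real.sin θ + 2 * Real.cos (θ + φ) * Real.sin φ := by
    rw [two_mul φ, ← add_assoc, Real.sin_add (θ + φ) φ, Real.sin_add, Real.cos_add]
    linear_combination Real.sin θ * Real.sin_sq_add_cos_sq φ
  rw [circlePoint, circlePoint, hc, hs]
  push_cast
  module

variable {K : Submodule ℂ E} [K.HasOrthogonalProjection] {R : E ≃ₗᵢ[ℂ] E}

/-- One step of the algorithm: `R` (which makes the query), a rotation by `2 * φ` in the plane of
`e` and `o`, and the reflection through `K`. -/
def walkStep (K : Submodule ℂ E) [K.HasOrthogonalProjection] (e o : E) (φ : ℝ) (R : E ≃ₗᵢ[ℂ] E) :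
    E ≃ₗᵢ[ℂ] E :=
  R.trans ((planeRotation e o φ).trans K.reflection)

/-- If `o + r` is orthogonal to `K` and `R` negates `r`, the walk hardly moves `e`. -/
theorem norm_iterate_walkStep_sub_le_of_mem_orthogonal (he : ‖e‖ = 1) (ho : ‖o‖ = 1)
    (heo : inner ℂ e o = 0) (heK : e ∈ K) (hRe : R e = e) (hRo : R o = o)
    {r : E} (her : inner ℂ e r = 0) (hor : inner ℂ o r = 0) (hRr : R r = -r)
    (hrK : o + r ∈ Kᗮ) {φ : ℝ} (h0 : 0 ≤ φ) (h1 : φ ≤ 1) (T : ℕ) :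
    ‖(walkStep K e o φ R)^[T] e - e‖ ≤ 4 * φ * ‖o + r‖ := by
  set V := walkStep K e o φ R with hV
  -- The exact fixed vector: `R` flips the sign of `r`, the rotation carries angle `-φ` to `φ`, and
  -- the reflection negates `o + r`, which restores `z`.
  set z : E := (Real.cos φ : ℂ) • e - (Real.sin φ : ℂ) • (o + r) with hz
  have hVz : V z = z := by
    have hRz : R z = circlePoint e o (-φ) + (Real.sin φ : ℂ) • r := by
      rw [hz, map_sub, map_smul, map_smul, map_add, hRe, hRo, hRr, circlePoint, Real.cos_neg,
        Real.sin_neg, Complex.ofReal_neg]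
      module
    rw [hV, walkStep, LinearIsometryEquiv.trans_apply, LinearIsometryEquiv.trans_apply, hRz,
      map_add, map_smul, planeRotation_circlePoint he ho heo,
      planeRotation_apply_of_orthogonal he ho heo φ her hor,
      show -φ + 2 * φ = φ by ring,
      show circlePoint e o φ + (Real.sin φ : ℂ) • r
        = (Real.cos φ : ℂ) • e + (Real.sin φ : ℂ) • (o + r) by rw [circlePoint]; module,
      map_add, map_smul, map_smul, K.reflection_mem_subspace_eq_self heK,
      K.reflection_mem_subspace_orthogonalComplement_eq_neg hrK, hz]
    module
  -- The error between `cos φ • e` and `z` is only moved by an isometry, so its norm does not depend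
  -- on `T`.
  have hVT : ∀ T : ℕ, ∃ w : E, ‖w‖ = ‖o + r‖ ∧
      (Real.cos φ : ℂ) • V^[T] e = z + (Real.sin φ : ℂ) • w := by
    intro T
    induction T with
    | zero => exact ⟨o + r, rfl, by rw [hz, Function.iterate_zero, id]; module⟩
    | succ T ih =>
      obtain ⟨w, hw, h⟩ := ih
      refine ⟨V w, by rw [V.norm_map, hw], ?_⟩
      rw [Function.iterate_succ_apply', ← map_smul, h, map_add, map_smul, hVz]
  obtain ⟨w, hw, h⟩ := hVT T
  have hsin : Real.sin φ ≤ φ := Real.sin_le h0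
  have hsin0 : 0 ≤ Real.sin φ :=
    Real.sin_nonneg_of_nonneg_of_le_pi h0 (h1.trans (by linarith [Real.pi_gt_three]))
  have hcos : 1 / 2 ≤ Real.cos φ := by
    nlinarith [Real.one_sub_sq_div_two_le_cos (x := φ)]
  have hdiff : (Real.cos φ : ℂ) • (V^[T] e - e) = (Real.sin φ : ℂ) • (w - (o + r)) := by
    rw [smul_sub, h, hz]
    module
  have hn := congrArg norm hdiff
  rw [norm_smul, norm_smul, Complex.norm_real, Complex.norm_real, Real.norm_of_nonneg hsin0,
    Real.norm_of_nonneg (by linarith)] at hn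
  have hw2 : ‖w - (o + r)‖ ≤ 2 * ‖o + r‖ := (norm_sub_le _ _).trans (by rw [hw]; linarith)
  have hle : Real.sin φ * ‖w - (o + r)‖ ≤ φ * (2 * ‖o + r‖) :=
    mul_le_mul hsin hw2 (norm_nonneg _) h0
  nlinarith [mul_le_mul_of_nonneg_right hcos (norm_nonneg (V^[T] e - e))]

/-- If `o + r` lies in `K` and `R` fixes `r`, the walk takes `e` close to `o` in a quarter turn. -/
theorem norm_iterate_walkStep_sub_le_of_mem (he : ‖e‖ = 1) (ho : ‖o‖ = 1)
    (heo : inner ℂ e o = 0) (heK : e ∈ K) (hRe : R e = e) (hRo : R o = o)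
    {r : E} (her : inner ℂ e r = 0) (hor : inner ℂ o r = 0) (hRr : R r = r)
    (hrK : o + r ∈ K) {T : ℕ} (hT : 0 < T) :
    ‖(walkStep K e o (Real.pi / (4 * T)) R)^[T] e - o‖ ≤ 2 * ‖r‖ := by
  set φ := Real.pi / (4 * T) with hφ
  have hT' : (0 : ℝ) < T := by exact_mod_cast hT
  have hφT : 2 * φ * T = Real.pi / 2 := by rw [hφ]; field_simp; ring
  have hφ0 : 0 ≤ φ := by positivity
  set V := walkStep K e o φ R with hV
  -- The moving target `cos θ • e + sin θ • (o + r)` lies in `K` and is fixed by `R`. The rotation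
  -- advances its circle part but leaves `sin θ • r` behind, and this lag is the whole error of a
  -- step.
  have step : ∀ θ, V (circlePoint e o θ + (Real.sin θ : ℂ) • r)
      = circlePoint e o (θ + 2 * φ) + (Real.sin (θ + 2 * φ) : ℂ) • r
        + ((Real.sin θ - Real.sin (θ + 2 * φ) : ℝ) : ℂ) • K.reflection r := by
    intro θ
    have hR : R (circlePoint e o θ + (Real.sin θ : ℂ) • r)
        = circlePoint e o θ + (Real.sin θ : ℂ) • r := by
      rw [circlePoint, map_add, map_add, map_smul, map_smul, map_smul, hRe, hRo, hRr]
    have hK : ∀ θ, K.reflection (circlePoint e o θ + (Real.sin θ : ℂ) • r)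
        = circlePoint e o θ + (Real.sin θ : ℂ) • r := by
      intro θ
      refine K.reflection_mem_subspace_eq_self ?_
      have : circlePoint e o θ + (Real.sin θ : ℂ) • r
          = (Real.cos θ : ℂ) • e + (Real.sin θ : ℂ) • (o + r) := by rw [circlePoint]; module
      rw [this]
      exact K.add_mem (K.smul_mem _ heK) (K.smul_mem _ hrK)
    rw [hV, walkStep, LinearIsometryEquiv.trans_apply, LinearIsometryEquiv.trans_apply, hR,
      map_add, map_smul, planeRotation_circlePoint he ho heo,
      planeRotation_apply_of_orthogonal he ho heo φ her hor]
    have := hK (θ + 2 * φ)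
    rw [map_add, map_smul] at this
    rw [map_add, map_smul, ← this]
    push_cast
    module
  -- The step errors `(sin (θ + 2φ) - sin θ) * ‖r‖` telescope because sine increases up to `π / 2`,
  -- so the total does not grow with `T`.
  have main : ∀ k : ℕ, k ≤ T → ‖V^[k] e - (circlePoint e o (2 * φ * k)
      + (Real.sin (2 * φ * k) : ℂ) • r)‖ ≤ Real.sin (2 * φ * k) * ‖r‖ := by
    intro k
    induction k with
    | zero => intro _; simp [circlePoint]
    | succ k ih =>
      intro hk
      have ih := ih (by omega)
      have hk' : (k : ℝ) + 1 ≤ T := by exact_mod_cast hk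
      have hang : 2 * φ * ((k + 1 : ℕ) : ℝ) = 2 * φ * k + 2 * φ := by push_cast; ring
      have hmono : Real.sin (2 * φ * k) ≤ Real.sin (2 * φ * k + 2 * φ) := by
        refine Real.sin_le_sin_of_le_of_le_pi_div_two ?_ ?_ (by linarith)
        · have : 0 ≤ 2 * φ * k := by positivity
          linarith [Real.pi_pos]
        · rw [← hφT]
          nlinarith
      rw [Function.iterate_succ_apply', hang]
      set a := circlePoint e o (2 * φ * k) + (Real.sin (2 * φ * k) : ℂ) • r with ha
      set b := circlePoint e o (2 * φ * k + 2 * φ)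
        + (Real.sin (2 * φ * k + 2 * φ) : ℂ) • r with hb
      have hVa := step (2 * φ * k)
      rw [← ha, ← hb] at hVa
      have hsplit : V (V^[k] e) - b = V (V^[k] e - a)
          + ((Real.sin (2 * φ * k) - Real.sin (2 * φ * k + 2 * φ) : ℝ) : ℂ) • K.reflection r := by
        rw [map_sub, hVa]
        abel
      rw [hsplit]
      refine (norm_add_le _ _).trans ?_
      rw [V.norm_map, norm_smul, LinearIsometryEquiv.norm_map, Complex.norm_real,
        Real.norm_of_nonpos (by linarith)]
      linarith
  have hfin := main T le_rfl
  rw [hφT, Real.sin_pi_div_two, one_mul] at hfin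
  have hcp : circlePoint e o (Real.pi / 2) = o := by simp [circlePoint]
  rw [hcp, Complex.ofReal_one, one_smul] at hfin
  calc ‖V^[T] e - o‖ = ‖(V^[T] e - (o + r)) + r‖ := by congr 1; abel
    _ ≤ ‖V^[T] e - (o + r)‖ + ‖r‖ := norm_add_le _ _
    _ ≤ 2 * ‖r‖ := by linarith

end SlowRotation

/-! ### Query algorithms that repeat a unitary step -/

section WalkAlgorithm

variable {n : ℕ}

/-- The Hilbert space `ℂⁿ ⊗ ℂ² ⊗ ℂʷ` of a query algorithm. -/
abbrev QuerySpace (n w : ℕ) : Type := EuclideanSpace ℂ (BasisState n w)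

/-- The matrix of an operator on `ℂ^ι`. -/
def operatorMatrix {ι : Type*} [Fintype ι] [DecidableEq ι]
    (L : EuclideanSpace ℂ ι →L[ℂ] EuclideanSpace ℂ ι) : Matrix ι ι ℂ :=
  (Matrix.toEuclideanCLM (n := ι) (𝕜 := ℂ)).symm L

theorem toLp_operatorMatrix_mulVec {ι : Type*} [Fintype ι] [DecidableEq ι]
    (L : EuclideanSpace ℂ ι →L[ℂ] EuclideanSpace ℂ ι) (ψ : ι → ℂ) :
    WithLp.toLp 2 (operatorMatrix L *ᵥ ψ) = L (WithLp.toLp 2 ψ) := by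
  rw [← Matrix.toEuclideanCLM_toLp, operatorMatrix, StarAlgEquiv.apply_symm_apply]

theorem operatorMatrix_star {ι : Type*} [Fintype ι] [DecidableEq ι]
    (L : EuclideanSpace ℂ ι →L[ℂ] EuclideanSpace ℂ ι) :
    operatorMatrix (star L) = star (operatorMatrix L) :=
  (Matrix.toEuclideanCLM (n := ι) (𝕜 := ℂ)).symm.map_star' L

theorem operatorMatrix_mul {ι : Type*} [Fintype ι] [DecidableEq ι]
    (L L' : EuclideanSpace ℂ ι →L[ℂ] EuclideanSpace ℂ ι) :
    operatorMatrix (L * L') = operatorMatrix L * operatorMatrix L' :=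
  map_mul (Matrix.toEuclideanCLM (n := ι) (𝕜 := ℂ)).symm L L'

theorem isStarProjection_operatorMatrix {ι : Type*} [Fintype ι] [DecidableEq ι]
    (K : Submodule ℂ (EuclideanSpace ℂ ι)) :
    IsStarProjection (operatorMatrix K.starProjection) := by
  have h := isStarProjection_starProjection (U := K)
  refine ⟨?_, ?_⟩
  · rw [IsIdempotentElem, ← operatorMatrix_mul, h.isIdempotentElem.eq]
  · rw [isSelfAdjoint_iff, ← operatorMatrix_star, h.isSelfAdjoint.star_eq]

/-- The matrix of a linear isometry of `ℂ^ι`. -/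
def unitaryMatrix {ι : Type*} [Fintype ι] [DecidableEq ι]
    (L : EuclideanSpace ℂ ι ≃ₗᵢ[ℂ] EuclideanSpace ℂ ι) : Matrix.unitaryGroup ι ℂ :=
  ⟨operatorMatrix (Unitary.linearIsometryEquiv.symm L).1, by
    rw [Matrix.mem_unitaryGroup_iff', ← operatorMatrix_star, ← operatorMatrix_mul,
      Unitary.star_mul_self_of_mem (Unitary.linearIsometryEquiv.symm L).2]
    exact map_one (Matrix.toEuclideanCLM (n := ι) (𝕜 := ℂ)).symm⟩

theorem toLp_unitaryMatrix_mulVec {ι : Type*} [Fintype ι] [DecidableEq ι]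
    (L : EuclideanSpace ℂ ι ≃ₗᵢ[ℂ] EuclideanSpace ℂ ι) (ψ : ι → ℂ) :
    WithLp.toLp 2 ((unitaryMatrix L).1 *ᵥ ψ) = L (WithLp.toLp 2 ψ) :=
  toLp_operatorMatrix_mulVec _ ψ

/-- The permutation of the basis states that the oracle performs. -/
def oraclePerm (w : ℕ) (x : Fin n → Bool) : Equiv.Perm (BasisState n w) :=
  Function.Involutive.toPerm (fun p => (p.1, Bool.xor p.2.1 (x p.1), p.2.2)) fun p => by simp

/-- The oracle as a linear isometry. -/
def oracleIsometry (w : ℕ) (x : Fin n → Bool) : QuerySpace n w ≃ₗᵢ[ℂ] QuerySpace n w :=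
  LinearIsometryEquiv.piLpCongrLeft 2 ℂ ℂ (oraclePerm w x)

theorem oracleIsometry_apply {w : ℕ} (x : Fin n → Bool) (ψ : QuerySpace n w) (p : BasisState n w) :
    oracleIsometry w x ψ p = ψ (p.1, Bool.xor p.2.1 (x p.1), p.2.2) := rfl

theorem toLp_oracle_mulVec {w : ℕ} (x : Fin n → Bool) (ψ : BasisState n w → ℂ) :
    WithLp.toLp 2 (oracle w x *ᵥ ψ) = oracleIsometry w x (WithLp.toLp 2 ψ) := by
  ext p
  rw [oracleIsometry_apply]
  change ∑ q, oracle w x p q * ψ q = _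
  -- The permutation is an involution, so row `p` has its only nonzero entry at the image of `p`.
  rw [Finset.sum_eq_single (oraclePerm w x p)]
  · have h : p = oraclePerm w x (oraclePerm w x p) := ((oraclePerm w x).left_inv p).symm
    have h1 : oracle w x p (oraclePerm w x p) = 1 := if_pos h
    rw [h1, one_mul]
    rfl
  · intro q _ hq
    have : p ≠ oraclePerm w x q := fun h => hq <| by
      rw [h]
      exact ((oraclePerm w x).left_inv q).symm
    have h0 : oracle w x p q = 0 := if_neg this
    rw [h0, zero_mul]
  · simp

theorem QueryAlgorithm.prob_eq_norm_sq (Q : QueryAlgorithm n) (x : Fin n → Bool) (b : Bool) :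
    Q.prob x b = ‖WithLp.toLp 2 (Q.outcomeProj b *ᵥ Q.state x Q.queries)‖ ^ 2 := by
  rw [EuclideanSpace.norm_sq_eq]
  rfl

/-- The algorithm that prepares `L₀ |start⟩`, performs `T` times a query followed by `L`, and
measures the projector onto `K`. -/
def walkAlgorithm {w : ℕ} (L₀ L : QuerySpace n w ≃ₗᵢ[ℂ] QuerySpace n w) (T : ℕ)
    (start : BasisState n w) (K : Submodule ℂ (QuerySpace n w)) : QueryAlgorithm n where
  work := w
  queries := T
  U t := if t = 0 then unitaryMatrix L₀ else unitaryMatrix L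
  start := start
  accept := operatorMatrix K.starProjection
  accept_proj := isStarProjection_operatorMatrix K

variable {w : ℕ} (L₀ L : QuerySpace n w ≃ₗᵢ[ℂ] QuerySpace n w) (T : ℕ)
  (start : BasisState n w) (K : Submodule ℂ (QuerySpace n w)) (x : Fin n → Bool)

theorem toLp_state_walkAlgorithm (t : ℕ) :
    WithLp.toLp 2 ((walkAlgorithm L₀ L T start K).state x t)
      = ((oracleIsometry w x).trans L)^[t] (L₀ (EuclideanSpace.single start 1)) := by
  induction t with
  | zero => exact toLp_unitaryMatrix_mulVec L₀ _
  | succ t ih =>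
    rw [Function.iterate_succ_apply']
    refine (toLp_unitaryMatrix_mulVec L _).trans (congrArg L ?_)
    exact (toLp_oracle_mulVec x _).trans (congrArg (oracleIsometry w x) ih)

theorem toLp_outcomeProj_walkAlgorithm (b : Bool) (ψ : BasisState n w → ℂ) :
    WithLp.toLp 2 ((walkAlgorithm L₀ L T start K).outcomeProj b *ᵥ ψ)
      = (if b then K else Kᗮ).starProjection (WithLp.toLp 2 ψ) := by
  cases b
  · have h : WithLp.toLp 2 (((1 : Matrix (BasisState n w) (BasisState n w) ℂ)
        - operatorMatrix K.starProjection) *ᵥ ψ) = Kᗮ.starProjection (WithLp.toLp 2 ψ) := by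
      rw [Matrix.sub_mulVec, Matrix.one_mulVec, WithLp.toLp_sub, toLp_operatorMatrix_mulVec,
        Submodule.starProjection_orthogonal']
      rfl
    exact h
  · exact toLp_operatorMatrix_mulVec _ ψ

theorem prob_walkAlgorithm (b : Bool) :
    (walkAlgorithm L₀ L T start K).prob x b = ‖(if b then K else Kᗮ).starProjection
      (((oracleIsometry w x).trans L)^[T] (L₀ (EuclideanSpace.single start 1)))‖ ^ 2 := by
  have h := (congrArg (if b then K else Kᗮ).starProjection
    (toLp_state_walkAlgorithm L₀ L T start K x T)).symm.trans
      (toLp_outcomeProj_walkAlgorithm L₀ L T start K b _).symm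
  exact ((walkAlgorithm L₀ L T start K).prob_eq_norm_sq x b).trans
    (congrArg (fun ψ : QuerySpace n w => ‖ψ‖ ^ 2) h.symm)

/-- Projections are contractions, so the projected state has norm at least `5/6`, and `25/36 > 2/3`.
-/
theorem two_thirds_le_prob_walkAlgorithm {b : Bool} {g : QuerySpace n w} (hg : ‖g‖ = 1)
    (hgK : g ∈ if b then K else Kᗮ)
    (h : ‖((oracleIsometry w x).trans L)^[T] (L₀ (EuclideanSpace.single start 1)) - g‖ ≤ 1 / 6) :
    2 / 3 ≤ (walkAlgorithm L₀ L T start K).prob x b := by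
  rw [prob_walkAlgorithm]
  set ψ := ((oracleIsometry w x).trans L)^[T] (L₀ (EuclideanSpace.single start 1))
  set K' := if b then K else Kᗮ
  have h1 : ‖K'.starProjection ψ - g‖ ≤ 1 / 6 := by
    have : K'.starProjection ψ - g = K'.starProjection (ψ - g) := by
      rw [map_sub, Submodule.starProjection_eq_self_iff.2 hgK]
    rw [this]
    exact (K'.norm_starProjection_apply_le _).trans h
  have h2 : ‖g‖ ≤ ‖K'.starProjection ψ‖ + ‖K'.starProjection ψ - g‖ :=
    norm_le_norm_add_norm_sub _ _
  have h3 : 5 / 6 ≤ ‖K'.starProjection ψ‖ := by linarith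
  nlinarith

end WalkAlgorithm

/-! ### The encoding of a deciding vector set -/

section Encoding

variable {n k : ℕ}

/-- Workspace labels: two for the plane of rotation, and `(b, c)` for the coordinate `c` of a
vector attached to the value `b` of an input bit. -/
abbrev WorkLabel (k : ℕ) : Type := Bool ⊕ (Bool × Fin k)

/-- The dimension of the workspace. -/
abbrev workDim (k : ℕ) : ℕ := Fintype.card (WorkLabel k)

theorem workDim_eq (k : ℕ) : workDim k = 2 + 2 * k := by simp [workDim]

/-- The vector with the given amplitudes. -/
def ofLabels (g : Fin n → Bool → WorkLabel k → ℂ) : QuerySpace n (workDim k) :=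
  WithLp.toLp 2 fun p => g p.1 p.2.1 ((Fintype.equivFin (WorkLabel k)).symm p.2.2)

theorem inner_ofLabels (g h : Fin n → Bool → WorkLabel k → ℂ) :
    inner ℂ (ofLabels g) (ofLabels h)
      = ∑ j, ∑ b, ((∑ i, star (g j b (.inl i)) * h j b (.inl i))
        + ∑ b', ∑ c, star (g j b (.inr (b', c))) * h j b (.inr (b', c))) := by
  rw [PiLp.inner_apply, Fintype.sum_prod_type]
  refine Finset.sum_congr rfl fun j _ => ?_
  rw [Fintype.sum_prod_type]
  refine Finset.sum_congr rfl fun b _ => ?_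
  rw [← Fintype.sum_prod_type' (f := fun b' c => star (g j b (.inr (b', c))) * h j b (.inr (b', c))),
    ← Fintype.sum_sum_type (f := fun l => star (g j b l) * h j b l),
    ← (Fintype.equivFin (WorkLabel k)).symm.sum_comp]
  exact Finset.sum_congr rfl fun a _ => mul_comm _ _

/-- The sign by which the algorithm multiplies a workspace label. -/
def labelSign : WorkLabel k → ℂ
  | .inr (true, _) => -1
  | _ => 1

/-- The diagonal isometry with entries `labelSign`. -/
def signIsometry (n k : ℕ) : QuerySpace n (workDim k) ≃ₗᵢ[ℂ] QuerySpace n (workDim k) :=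
  LinearIsometryEquiv.piLpCongrRight 2 fun p =>
    match (Fintype.equivFin (WorkLabel k)).symm p.2.2 with
    | .inr (true, _) => LinearIsometryEquiv.neg ℂ
    | _ => LinearIsometryEquiv.refl ℂ ℂ

theorem signIsometry_oracleIsometry_ofLabels (x : Fin n → Bool)
    (g : Fin n → Bool → WorkLabel k → ℂ) :
    ((oracleIsometry (workDim k) x).trans (signIsometry n k)) (ofLabels g)
      = ofLabels fun j b l => labelSign l * g j (Bool.xor b (x j)) l := by
  ext p
  have h : oracleIsometry (workDim k) x (ofLabels g) p
      = g p.1 (Bool.xor p.2.1 (x p.1)) ((Fintype.equivFin (WorkLabel k)).symm p.2.2) := rfl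
  rw [LinearIsometryEquiv.trans_apply, signIsometry, LinearIsometryEquiv.piLpCongrRight_apply]
  simp only [ofLabels]
  rw [← ofLabels, h]
  rcases (Fintype.equivFin (WorkLabel k)).symm p.2.2 with i | ⟨_ | _, c⟩ <;> simp [labelSign]

/-- The amplitude `1/√2`. -/
def halfAmp : ℂ := ((Real.sqrt 2)⁻¹ : ℝ)

theorem star_halfAmp_mul_halfAmp : star halfAmp * halfAmp = 1 / 2 := by
  have : (Real.sqrt 2)⁻¹ * (Real.sqrt 2)⁻¹ = (1 / 2 : ℝ) := by
    rw [← mul_inv, Real.mul_self_sqrt (by norm_num)]; norm_num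
  rw [halfAmp, Complex.star_def, Complex.conj_ofReal, ← Complex.ofReal_mul, this]
  norm_num

/-- The state `|j⟩|+⟩` with one of the first two workspace labels. -/
def axisVec (k : ℕ) (j : Fin n) (i : Bool) : QuerySpace n (workDim k) :=
  ofLabels fun j' _ l => if j' = j ∧ l = .inl i then halfAmp else 0

/-- The vector `∑_j |j⟩|-⟩|z_j, u_j⟩`. -/
def phaseVec (z : Fin n → Bool) (u : Fin n → EuclideanSpace ℂ (Fin k)) :
    QuerySpace n (workDim k) :=
  ofLabels fun j b l => match l with
    | .inl _ => 0
    | .inr (b', c) => if b' = z j then (if b then -halfAmp else halfAmp) * u j c else 0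

theorem inner_axisVec (j : Fin n) (i i' : Bool) :
    inner ℂ (axisVec k j i) (axisVec k j i') = if i = i' then 1 else 0 := by
  rw [axisVec, axisVec, inner_ofLabels, Finset.sum_eq_single j]
  · cases i <;> cases i' <;>
      simp only [Fintype.sum_bool, star_halfAmp_mul_halfAmp, true_and, Sum.inl.injEq, reduceCtorEq,
        and_false, if_true, if_false, star_zero, mul_zero, zero_mul, add_zero, zero_add,
        Finset.sum_const_zero, Bool.false_eq_true, Bool.true_eq_false] <;> norm_num
  · intro j' _ hj'
    simp [hj']
  · simp

theorem norm_axisVec (j : Fin n) (i : Bool) : ‖axisVec k j i‖ = 1 := by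
  have h : ‖axisVec k j i‖ ^ 2 = 1 := by
    rw [← inner_self_eq_norm_sq (𝕜 := ℂ), inner_axisVec]; simp
  exact (sq_eq_sq₀ (norm_nonneg _) zero_le_one).1 (by rw [h, one_pow])

theorem inner_axisVec_phaseVec (j : Fin n) (i : Bool) (z : Fin n → Bool)
    (u : Fin n → EuclideanSpace ℂ (Fin k)) : inner ℂ (axisVec k j i) (phaseVec z u) = 0 := by
  rw [axisVec, phaseVec, inner_ofLabels]
  simp

/-- The label `z_j` makes coordinates where `z` and `z'` differ orthogonal. Taking `z' = ¬y` thus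
turns agreement into the condition `x_j ≠ y_j` of a deciding set. -/
theorem inner_phaseVec (z z' : Fin n → Bool) (u u' : Fin n → EuclideanSpace ℂ (Fin k)) :
    inner ℂ (phaseVec z u) (phaseVec z' u')
      = ∑ j : Fin n with z j = z' j, inner ℂ (u j) (u' j) := by
  rw [phaseVec, phaseVec, inner_ofLabels, Finset.sum_filter]
  refine Finset.sum_congr rfl fun j _ => ?_
  have key : ∀ c, star (halfAmp * u j c) * (halfAmp * u' j c)
      + star (halfAmp * u j c) * (halfAmp * u' j c) = inner ℂ (u j c) (u' j c) := fun c => by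
    rw [star_mul, ← two_mul, RCLike.inner_apply, ← Complex.star_def]
    linear_combination (2 * star (u j c) * u' j c) * star_halfAmp_mul_halfAmp
  rw [PiLp.inner_apply]
  simp only [← key, Finset.sum_add_distrib]
  cases z j <;> cases z' j <;> simp

theorem norm_sq_phaseVec (z : Fin n → Bool) (u : Fin n → EuclideanSpace ℂ (Fin k)) :
    ‖phaseVec z u‖ ^ 2 = ∑ j, ‖u j‖ ^ 2 := by
  rw [← inner_self_eq_norm_sq (𝕜 := ℂ), inner_phaseVec]
  simp only [Finset.filter_true, map_sum]
  exact Finset.sum_congr rfl fun j _ => inner_self_eq_norm_sq (𝕜 := ℂ) (u j)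

/-- The query, followed by the signs of the labels. -/
def querySign (k : ℕ) (x : Fin n → Bool) :
    QuerySpace n (workDim k) ≃ₗᵢ[ℂ] QuerySpace n (workDim k) :=
  (oracleIsometry (workDim k) x).trans (signIsometry n k)

theorem querySign_axisVec (x : Fin n → Bool) (j : Fin n) (i : Bool) :
    querySign k x (axisVec k j i) = axisVec k j i := by
  rw [querySign, axisVec, signIsometry_oracleIsometry_ofLabels]
  congr 1
  funext j' b l
  split_ifs with h
  · rw [h.2]; simp [labelSign]
  · simp

/-- On `|-⟩` the query acts as the phase `(-1)^{x_j}`, and the label sign contributes the same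
factor, so they cancel. With negated labels the product is `-1`. -/
theorem querySign_phaseVec (x : Fin n → Bool) (u : Fin n → EuclideanSpace ℂ (Fin k)) :
    querySign k x (phaseVec x u) = phaseVec x u := by
  rw [querySign, phaseVec, signIsometry_oracleIsometry_ofLabels]
  congr 1
  funext j b l
  rcases l with i | ⟨b', c⟩
  · simp
  · cases b' <;> cases b <;> cases x j <;> simp [labelSign]

theorem querySign_phaseVec_not (x : Fin n → Bool) (u : Fin n → EuclideanSpace ℂ (Fin k)) :
    querySign k x (phaseVec (fun j => !x j) u) = -phaseVec (fun j => !x j) u := by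
  have hneg : -phaseVec (fun j => !x j) u
      = ofLabels fun j b l => -(match l with
        | .inl _ => 0
        | .inr (b', c) => if b' = !x j then (if b then -halfAmp else halfAmp) * u j c else 0) := rfl
  rw [hneg, querySign, phaseVec, signIsometry_oracleIsometry_ofLabels]
  congr 1
  funext j b l
  rcases l with i | ⟨b', c⟩
  · simp
  · cases b' <;> cases b <;> cases x j <;> simp [labelSign]

/-- The axis vector is a rotated basis state. -/
theorem exists_isometry_single_eq_axisVec (j : Fin n) (i : Bool) :
    ∃ (p : BasisState n (workDim k)) (L : QuerySpace n (workDim k) ≃ₗᵢ[ℂ] QuerySpace n (workDim k)),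
      L (EuclideanSpace.single p 1) = axisVec k j i := by
  let a := Fintype.equivFin (WorkLabel k) (.inl i)
  let p : BasisState n (workDim k) := (j, false, a)
  let q : BasisState n (workDim k) := (j, true, a)
  have hpq : inner ℂ (EuclideanSpace.single p (1 : ℂ)) (EuclideanSpace.single q (1 : ℂ)) = 0 := by
    rw [EuclideanSpace.inner_single_left]
    simp [p, q]
  -- `planeRotation` doubles its angle, so `π / 8` turns the answer bit `|0⟩` by `π / 4` into `|+⟩`.
  refine ⟨p, planeRotation (EuclideanSpace.single p 1) (EuclideanSpace.single q 1)
    (Real.pi / 8), ?_⟩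
  have h := planeRotation_circlePoint (by simp) (by simp) hpq (Real.pi / 8) 0
  have h0 : circlePoint (EuclideanSpace.single p (1 : ℂ)) (EuclideanSpace.single q (1 : ℂ)) 0
      = EuclideanSpace.single p 1 := by simp [circlePoint]
  have hs : Real.sqrt 2 / 2 = (Real.sqrt 2)⁻¹ := by
    rw [div_eq_iff two_ne_zero, eq_comm, inv_mul_eq_iff_eq_mul₀ (by positivity),
      Real.mul_self_sqrt (by norm_num)]
  rw [h0, show (0 : ℝ) + 2 * (Real.pi / 8) = Real.pi / 4 by ring, circlePoint, Real.cos_pi_div_four,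
    Real.sin_pi_div_four, hs] at h
  rw [h]
  ext ⟨j', b, a'⟩
  have ha : (Fintype.equivFin (WorkLabel k)).symm a' = Sum.inl i ↔ a' = a := by
    rw [Equiv.symm_apply_eq]
  simp only [PiLp.add_apply, PiLp.smul_apply, PiLp.single_apply, smul_eq_mul, axisVec,
    ofLabels, ha, p, q, Prod.mk.injEq]
  by_cases hj : j' = j <;> by_cases ha' : a' = a <;> cases b <;> simp [hj, ha', halfAmp]

end Encoding

/-! ### The algorithm -/

section Algorithm

variable {n k : ℕ} {X : Set (Fin n → Bool)} {f : X → Bool}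

/-- The factors `α` and `-α⁻¹` multiply to `-1`, so the phase parts contribute `-1` against the `1`
from the axis vector. -/
theorem inner_axisVec_add_phaseVec {x y : Fin n → Bool} {u u' : Fin n → EuclideanSpace ℂ (Fin k)}
    {α : ℝ} (hα : α ≠ 0) (h : ∑ j : Fin n with x j ≠ y j, inner ℂ (u j) (u' j) = 1) (j : Fin n) :
    inner ℂ (axisVec k j true + phaseVec x (fun j => (α : ℂ) • u j))
      (axisVec k j true + phaseVec (fun j => !y j) (fun j => (-α⁻¹ : ℂ) • u' j)) = 0 := by
  have h1 : inner ℂ (phaseVec x (fun j => (α : ℂ) • u j)) (axisVec k j true) = 0 := by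
    rw [← inner_conj_symm, inner_axisVec_phaseVec, map_zero]
  have h2 : ∀ i, (x i = !y i) ↔ x i ≠ y i := fun i => by cases x i <;> cases y i <;> simp
  have h3 : (α : ℂ) ≠ 0 := by exact_mod_cast hα
  rw [inner_add_left, inner_add_right, inner_add_right, inner_axisVec, inner_axisVec_phaseVec, h1,
    inner_phaseVec]
  simp only [h2, inner_smul_left, inner_smul_right, Complex.conj_ofReal]
  rw [← Finset.mul_sum, ← Finset.mul_sum, h]
  simp [h3]

/-- The span of `e` and of the vectors `o + α ∑_j |j⟩|-⟩|x_j, u_{x,j}⟩` of the `1`-inputs. -/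
def walkSpace (f : X → Bool) (u : X → Fin n → EuclideanSpace ℂ (Fin k)) (α : ℝ) (j : Fin n) :
    Submodule ℂ (QuerySpace n (workDim k)) :=
  Submodule.span ℂ (insert (axisVec k j false)
    {t | ∃ x : X, f x = true ∧
      axisVec k j true + phaseVec x.1 (fun i => (α : ℂ) • u x i) = t})

theorem add_phaseVec_mem_orthogonal_walkSpace {u : X → Fin n → EuclideanSpace ℂ (Fin k)}
    (hu : IsDeciding f u) {α : ℝ} (hα : α ≠ 0) (j : Fin n) {y : X} (hy : f y = false) :
    axisVec k j true + phaseVec (fun i => !y.1 i) (fun i => (-α⁻¹ : ℂ) • u y i)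
      ∈ (walkSpace f u α j)ᗮ := by
  set s := axisVec k j true + phaseVec (fun i => !y.1 i) (fun i => (-α⁻¹ : ℂ) • u y i)
  suffices h : walkSpace f u α j ≤ (ℂ ∙ s)ᗮ from
    (Submodule.mem_orthogonal _ _).2 fun t ht =>
      (Submodule.mem_orthogonal_singleton_iff_inner_left).1 (h ht)
  refine Submodule.span_le.2 ?_
  rintro t (rfl | ⟨x, hx, rfl⟩)
  · refine Submodule.mem_orthogonal_singleton_iff_inner_left.2 ?_
    rw [inner_add_right, inner_axisVec, inner_axisVec_phaseVec]
    simp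
  · refine Submodule.mem_orthogonal_singleton_iff_inner_left.2 ?_
    exact inner_axisVec_add_phaseVec hα (hu x y (by simp [hx, hy])) j

theorem exists_queryAlgorithm_of_isDeciding {u : X → Fin n → EuclideanSpace ℂ (Fin k)}
    (hu : IsDeciding f u) {A : ℝ} (hA : 1 ≤ A) (hsize : ∀ x, ∑ j, ‖u x j‖ ^ 2 ≤ A) (j : Fin n)
    {T : ℕ} (hT : 312 * A ≤ T) :
    ∃ Q : QueryAlgorithm n, Q.Decides f ∧ Q.queries = T ∧ Q.work = workDim k := by
  obtain ⟨p, L₀, hL₀⟩ := exists_isometry_single_eq_axisVec (k := k) j false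
  -- This `α` gives `‖r‖ ≤ 1/12` on `1`-inputs, hence error `1/6`, and `‖r‖ ≤ 12 * A` on `0`-inputs.
  -- There `1 + 144 * A² ≤ (13 * A)²`, and `312 = 6 * 4 * 13` gives error `1/6` again.
  set α : ℝ := Real.sqrt (1 / (144 * A)) with hα
  have hα2 : α ^ 2 = 1 / (144 * A) := Real.sq_sqrt (by positivity)
  have hα0 : 0 < α := Real.sqrt_pos.2 (by positivity)
  have hT0 : (0 : ℝ) < T := by linarith
  set e := axisVec k j false
  set o := axisVec k j true
  set K := walkSpace f u α j
  set φ := Real.pi / (4 * T) with hφ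
  have he : ‖e‖ = 1 := norm_axisVec j false
  have ho : ‖o‖ = 1 := norm_axisVec j true
  have heo : inner ℂ e o = 0 := by rw [inner_axisVec]; simp
  have heK : e ∈ K := Submodule.subset_span (Set.mem_insert _ _)
  -- Acceptance means having left `e`: the final state is near `e` on `0`-inputs and near `o` on
  -- `1`-inputs.
  refine ⟨walkAlgorithm L₀ ((signIsometry n k).trans ((planeRotation e o φ).trans K.reflection)) T p
    (ℂ ∙ e)ᗮ, fun x => ?_, rfl, rfl⟩
  have hwalk : (oracleIsometry (workDim k) x.1).trans
      ((signIsometry n k).trans ((planeRotation e o φ).trans K.reflection))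
      = walkStep K e o φ (querySign k x.1) := by
    rw [walkStep, querySign, LinearIsometryEquiv.trans_assoc]
  cases hx : f x
  · refine two_thirds_le_prob_walkAlgorithm _ _ _ _ _ _ he ?_ ?_
    · exact Submodule.le_orthogonal_orthogonal _ (Submodule.mem_span_singleton_self e)
    rw [hwalk, hL₀]
    set r := phaseVec (fun i => !x.1 i) (fun i => (-α⁻¹ : ℂ) • u x i) with hr
    have hφ0 : 0 ≤ φ := by positivity
    have hφT : φ ≤ 1 / (312 * A) := by
      rw [hφ, div_le_div_iff₀ (by positivity) (by positivity)]
      nlinarith [Real.pi_lt_four, Real.pi_pos]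
    have hφ1 : φ ≤ 1 := hφT.trans (by rw [div_le_one (by positivity)]; linarith)
    have hor : inner ℂ o r = 0 := inner_axisVec_phaseVec _ _ _ _
    have hnorm : ‖o + r‖ ≤ 13 * A := by
      have h1 : ‖r‖ ^ 2 ≤ 144 * A * A := by
        have : ‖r‖ ^ 2 = 144 * A * ∑ i, ‖u x i‖ ^ 2 := by
          rw [hr, norm_sq_phaseVec, Finset.mul_sum]
          refine Finset.sum_congr rfl fun i _ => ?_
          rw [norm_smul, mul_pow, norm_neg, Complex.norm_real, norm_inv, inv_pow,
            Real.norm_of_nonneg hα0.le, hα2, one_div, inv_inv]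
        rw [this]
        exact mul_le_mul_of_nonneg_left (hsize x) (by positivity)
      have h2 : ‖o + r‖ ^ 2 = 1 + ‖r‖ ^ 2 := by
        rw [sq, norm_add_sq_eq_norm_sq_add_norm_sq_of_inner_eq_zero _ _ hor, ho]
        ring
      refine le_of_sq_le_sq ?_ (by positivity)
      nlinarith
    refine (norm_iterate_walkStep_sub_le_of_mem_orthogonal he ho heo heK
      (querySign_axisVec _ _ _) (querySign_axisVec _ _ _) (inner_axisVec_phaseVec _ _ _ _) hor
      (querySign_phaseVec_not _ _)
      (add_phaseVec_mem_orthogonal_walkSpace hu hα0.ne' j hx) hφ0 hφ1 T).trans ?_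
    calc 4 * φ * ‖o + r‖ ≤ 4 * (1 / (312 * A)) * (13 * A) := by gcongr
      _ = 1 / 6 := by field_simp; norm_num
  · refine two_thirds_le_prob_walkAlgorithm _ _ _ _ _ _ ho ?_ ?_
    · exact Submodule.mem_orthogonal_singleton_iff_inner_right.2 heo
    rw [hwalk, hL₀]
    set r := phaseVec x.1 (fun i => (α : ℂ) • u x i) with hr
    have hrn : ‖r‖ ≤ 1 / 12 := by
      refine le_of_sq_le_sq ?_ (by norm_num)
      have : ‖r‖ ^ 2 = 1 / (144 * A) * ∑ i, ‖u x i‖ ^ 2 := by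
        rw [hr, norm_sq_phaseVec, Finset.mul_sum]
        refine Finset.sum_congr rfl fun i _ => ?_
        rw [norm_smul, mul_pow, Complex.norm_real, Real.norm_of_nonneg hα0.le, hα2]
      rw [this]
      calc 1 / (144 * A) * ∑ i, ‖u x i‖ ^ 2 ≤ 1 / (144 * A) * A :=
            mul_le_mul_of_nonneg_left (hsize x) (by positivity)
        _ = (1 / 12) ^ 2 := by field_simp; norm_num
    refine (norm_iterate_walkStep_sub_le_of_mem he ho heo heK
      (querySign_axisVec _ _ _) (querySign_axisVec _ _ _) (inner_axisVec_phaseVec _ _ _ _)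
      (inner_axisVec_phaseVec _ _ _ _) (querySign_phaseVec _ _)
      (Submodule.subset_span (Set.mem_insert_of_mem _ ⟨x, hx, rfl⟩))
      (by exact_mod_cast hT0)).trans ?_
    linarith

/-- For constant `f` the size may be `0`, so no query is allowed; a trivial measurement answers. -/
theorem exists_queryAlgorithm_of_const (j : Fin n) {b : Bool} (hf : ∀ x, f x = b) :
    ∃ Q : QueryAlgorithm n, Q.Decides f ∧ Q.queries = 0 ∧ Q.work = 1 := by
  let p : BasisState n 1 := (j, false, 0)
  let I := LinearIsometryEquiv.refl ℂ (QuerySpace n 1)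
  refine ⟨walkAlgorithm I I 0 p (if b then ⊤ else ⊥), fun x => ?_, rfl, rfl⟩
  rw [hf x]
  refine two_thirds_le_prob_walkAlgorithm _ _ _ _ _ _ (g := EuclideanSpace.single p 1)
    (by simp) ?_ (by simp [I])
  cases b <;> simp

theorem QueryAlgorithm.qubits_le (Q : QueryAlgorithm n) (hn : 1 ≤ n) {r : ℕ} (hr : 1 ≤ r)
    (hw : Q.work ≤ 4 * r) : (Q.qubits : ℝ) ≤ 4 * (1 + Real.logb 2 ((n : ℝ) * r)) := by
  have hN : 1 ≤ n * r := Nat.mul_pos hn hr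
  have h1 : Q.qubits ≤ 3 + Nat.clog 2 (n * r) := by
    refine Nat.clog_le_of_le_pow ?_
    have hcard : Fintype.card (BasisState n Q.work) = n * (2 * Q.work) := by simp
    have := Nat.le_pow_clog one_lt_two (n * r)
    rw [hcard, pow_add]
    nlinarith [Nat.mul_le_mul_left n hw]
  have hlog : 0 ≤ Real.logb 2 ((n * r : ℕ) : ℝ) :=
    Real.logb_nonneg one_lt_two (by exact_mod_cast hN)
  have h2 : (Nat.clog 2 (n * r) : ℝ) < Real.logb 2 ((n * r : ℕ) : ℝ) + 1 := by
    have := Nat.ceil_lt_add_one hlog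
    rw [← Real.natCeil_logb_natCast]
    exact_mod_cast this
  have h3 : (Q.qubits : ℝ) ≤ 3 + Nat.clog 2 (n * r) := by exact_mod_cast h1
  push_cast at hlog h2
  linarith

end Algorithm

end

theorem mainTheorem5 :
    ∃ C : ℝ, 0 < C ∧
      ∀ (n : ℕ) (_ : 1 ≤ n) (X : Set (Fin n → Bool)) (f : X → Bool)
        (m : ℕ) (v : X → Fin n → EuclideanSpace ℂ (Fin m)),
        IsDeciding f v →
        (∃ S : Fin n → (EuclideanSpace ℂ (Fin m) →ₗ[ℂ] EuclideanSpace ℂ (Fin (maxRank f v))),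
          (∀ j, IsPartialIsometryBetween (S j) (oneSpan f v j)
            (firstBasisSpan (maxRank f v) (rankAt f v j))) ∧
          IsDeciding f (fun x j => S j (v x j)) ∧
          vecSize (fun x j => S j (v x j)) ≤ vecSize v) ∧
        (∃ Q : QueryAlgorithm n,
          Q.Decides f ∧
          (Q.queries : ℝ) ≤ C * vecSize v ∧
          (Q.qubits : ℝ) ≤ C * (1 + Real.logb 2 ((n : ℝ) * (max 1 (maxRank f v) : ℕ)))) := by
  -- `⌈312 * A⌉ ≤ 313 * A` once `1 ≤ A`; the qubit bound needs only the constant `4`.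
  refine ⟨313, by norm_num, fun n hn X f m v hv => ?_⟩
  obtain ⟨S, hS, hdec, hle⟩ := exists_compression hv
  refine ⟨⟨S, hS, hdec, hle⟩, ?_⟩
  set r := max 1 (maxRank f v) with hr
  have hr1 : 1 ≤ r := le_max_left _ _
  have hlog : 0 ≤ Real.logb 2 ((n : ℝ) * r) :=
    Real.logb_nonneg one_lt_two (by exact_mod_cast Nat.mul_pos hn hr1)
  by_cases hconst : ∃ b, ∀ x, f x = b
  · obtain ⟨b, hb⟩ := hconst
    obtain ⟨Q, hQ, hQT, hQw⟩ := exists_queryAlgorithm_of_const ⟨0, hn⟩ hb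
    refine ⟨Q, hQ, ?_, (Q.qubits_le hn hr1 (by omega)).trans (by linarith)⟩
    rw [hQT]
    simpa using vecSize_nonneg v
  · push Not at hconst
    obtain ⟨x, hx⟩ := hconst true
    obtain ⟨y, hy⟩ := hconst (f x)
    have hA : 1 ≤ vecSize v := one_le_vecSize hv hy
    have hsize : ∀ x, ∑ j, ‖S j (v x j)‖ ^ 2 ≤ vecSize v := fun x =>
      (sum_norm_sq_le_vecSize (fun x j => S j (v x j)) x).trans hle
    obtain ⟨Q, hQ, hQT, hQw⟩ := exists_queryAlgorithm_of_isDeciding hdec hA hsize ⟨0, hn⟩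
      (Nat.le_ceil (312 * vecSize v))
    have hw : Q.work ≤ 4 * r := by
      rw [hQw, workDim_eq]
      omega
    refine ⟨Q, hQ, ?_, (Q.qubits_le hn hr1 hw).trans (by linarith)⟩
    rw [hQT]
    have := Nat.ceil_lt_add_one (show 0 ≤ 312 * vecSize v by positivity)
    linarith
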